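/- Let $\tau,\eta\in\mathbb C$ with $\operatorname{Im}\tau>0$, let $$\vartheta(u)=-\sum_{j\in\mathbb Z}\exp\Big(\pi i\big(j+\tfrac12\big)^2\tau+2\pi i\big(j+\tfrac12\big)\big(u+\tfrac12\big)\Big),$$ and assume $\vartheta(\eta)\neq0$ and $\vartheta(2\eta)\ne 0$. Let $V=\mathbb C^3$ with basis $e_1,e_2,e_3$, matrix units $E_{ij}$, and $h=E_{11}-E_{33}$. Write $q_{12}=q_1-q_2$ and put $$g(u)=\frac{\vartheta(u-\eta)\vartheta(u-2\eta)}{\vartheta(\eta)\vartheta(2\eta)},\quad \alpha(q_1,q_2,u)=\frac{\vartheta(\eta-u)\vartheta(q_{12}-u)}{\vartheta(\eta)\vartheta(q_{12})},\quad \beta(q_1,q_2,u)=\frac{\vartheta(\eta-u)\vartheta(u)\vartheta(q_{12}-2\eta)}{\vartheta(-2\eta)\vartheta(\eta)\vartheta(q_{12})},$$ $$\varepsilon(q,u)=\frac{\vartheta(\eta+u)\vartheta(2\eta-u)}{\vartheta(\eta)\vartheta(2\eta)}-\frac{\vartheta(u)\vartheta(\eta-u)}{\vartheta(\eta)\vartheta(2\eta)}\left(\frac{\vartheta(q+\eta)\vartheta(q-2\eta)}{\vartheta(q-\eta)\vartheta(q)}+\frac{\vartheta(q-\eta)\vartheta(q+2\eta)}{\vartheta(q+\eta)\vartheta(q)}\right),$$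 $$\gamma(q_1,q_2,u)=\frac{\vartheta(u)\vartheta(q_1+q_2-\eta-u)\vartheta(q_1-2\eta)\vartheta(q_2+\eta)}{\vartheta(\eta)\vartheta(q_1+q_2-2\eta)\vartheta(q_1+\eta)\vartheta(q_2)},\quad \delta(q,u)=\frac{\vartheta(u-q)\vartheta(u-q+\eta)}{\vartheta(q)\vartheta(q-\eta)},$$ \begin{align*} R(q,u)={}&g(u)E_{11}\otimes E_{11}+g(u)E_{33}\otimes E_{33}+\varepsilon(q,u)E_{22}\otimes E_{22}\\ &+\alpha(\eta,q,u)E_{12}\otimes E_{21}+\alpha(q,\eta,u)E_{21}\otimes E_{12}+\alpha(-q,\eta,u)E_{23}\otimes E_{32}+\alpha(\eta,-q,u)E_{32}\otimes E_{23}\\ &+\beta(\eta,q,u)E_{11}\otimes E_{22}+\beta(q,\eta,u)E_{22}\otimes E_{11}+\beta(-q,\eta,u)E_{22}\otimes E_{33}+\beta(\eta,-q,u)E_{33}\otimes E_{22}\\ &+\gamma(-q,q,u)E_{11}\otimes E_{33}+\gamma(-q,\eta,u)E_{12}\otimes E_{32}-\gamma(\eta,q,u)E_{21}\otimes E_{23}\\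 &+\gamma(q,-q,u)E_{33}\otimes E_{11}+\gamma(q,\eta,u)E_{32}\otimes E_{12}-\gamma(\eta,-q,u)E_{23}\otimes E_{21}\\ &+\delta(q,u)E_{31}\otimes E_{13}+\delta(-q,u)E_{13}\otimes E_{31}. \end{align*} A representation of $E_{\tau,\eta}(so_3)$ is a complex vector space $W$ (of arbitrary dimension) with a diagonalizable endomorphism $h$, so that $W=\bigoplus_{\lambda\in\mathbb C}W[\lambda]$ with $W[\lambda]$ the $\lambda$-eigenspace, together with a meromorphic function $\mathcal L(q,u)$ of $(q,u)\in\mathbb C^2$ with values in $\operatorname{End}(V\otimes W)$, such that $[h_V\otimes1+1\otimes h_W,\mathcal L(q,u)]=0$ and, on $V\otimes V\otimes W$, as an identity of meromorphic functions of $(q,u_1,u_2)$, $$R_{12}(q-2\eta h_3,u_1-u_2)\,\mathcal L_{13}(q,u_1)\,\mathcal L_{23}(q-2\eta h_1,u_2)=\mathcal L_{23}(q,u_2)\,\mathcal L_{13}(q-2\eta h_2,u_1)\,R_{12}(q,u_1-u_2).$$ Here $h_i$ is $h$ acting on the $i$-th factor, and a shift by $-2\eta h_i$ means: replace $h_i$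 by $\lambda$ on vectors whose $i$-th factor has weight $\lambda$. A vector-valued meromorphic function is a finite sum of scalar meromorphic functions times constant vectors, and $\mathcal L$ is meromorphic if $(q,u)\mapsto\mathcal L(q,u)x$ is meromorphic for every $x\in V\otimes W$. Let $\mathrm{Fun}(W)$ be the space of $W$-valued meromorphic functions of $q\in\mathbb C$, and $\mathrm{Fun}(W)[0]$ the subspace of those with values in $W[0]$. Call $u$ regular if $\mathcal L(\cdot,u)$ is defined as a meromorphic function of $q$, i.e. if for every $x\in V\otimes W$ the line of constant spectral parameter $u$ is not contained in the polar locus of $\mathcal L(\cdot,\cdot)x$. For regular $u$ let $L(u)=\mathcal L(q,u)e^{-2\eta h\partial_q}$ with $h$ acting on $V$, that is, the $3\times3$ matrix of operators with entries $(L_{ij}(u)f)(q)=\mathcal L_{ij}(q,u)f(q-2\eta h_j)$, where $(h_1,h_2,h_3)=(1,0,-1)$ are the diagonal entries of $h$ on $V$, and let $t(u)=\operatorname{Tr}_V L(u)=\sum_{i=1}^3L_{ii}(u)$ be the transfer matrix. **Theorem.** For every representation $W$ of $E_{\tau,\eta}(so_3)$ and every regular $u$, the operator $t(u)$ maps $\mathrm{Fun}(W)$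 into itself and preserves the subspace $\mathrm{Fun}(W)[0]$. On $\mathrm{Fun}(W)[0]$ one has $[t(u),t(v)]=0$ for all regular $u,v$. -/

import Mathlib

open Filter Topology
open scoped Kronecker

noncomputable section

namespace EllipticSO3

/-! ## Theta function and the dynamical R-matrix -/

/-- Jacobi's theta function
`ϑ(u) = -∑_{j ∈ ℤ} exp(π i (j + 1/2)² τ + 2 π i (j + 1/2) (u + 1/2))`. -/
def theta (τ u : ℂ) : ℂ :=
  -∑' j : ℤ, Complex.exp
    (Real.pi * Complex.I * ((j : ℂ) + 1 / 2) ^ 2 * τ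
      + 2 * Real.pi * Complex.I * ((j : ℂ) + 1 / 2) * (u + 1 / 2))

def gFun (τ η u : ℂ) : ℂ :=
  theta τ (u - η) * theta τ (u - 2 * η) / (theta τ η * theta τ (2 * η))

def alphaFun (τ η q₁ q₂ u : ℂ) : ℂ :=
  theta τ (η - u) * theta τ (q₁ - q₂ - u) / (theta τ η * theta τ (q₁ - q₂))

def betaFun (τ η q₁ q₂ u : ℂ) : ℂ :=
  theta τ (η - u) * theta τ u * theta τ (q₁ - q₂ - 2 * η)
    / (theta τ (-2 * η) * theta τ η * theta τ (q₁ - q₂))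

def epsFun (τ η q u : ℂ) : ℂ :=
  theta τ (η + u) * theta τ (2 * η - u) / (theta τ η * theta τ (2 * η))
    - theta τ u * theta τ (η - u) / (theta τ η * theta τ (2 * η))
      * (theta τ (q + η) * theta τ (q - 2 * η) / (theta τ (q - η) * theta τ q)
        + theta τ (q - η) * theta τ (q + 2 * η) / (theta τ (q + η) * theta τ q))

def gammaFun (τ η q₁ q₂ u : ℂ) : ℂ :=
  theta τ u * theta τ (q₁ + q₂ - η - u) * theta τ (q₁ - 2 * η) * theta τ (q₂ + η)
    / (theta τ η * theta τ (q₁ + q₂ - 2 * η) * theta τ (q₁ + η) * theta τ q₂)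

def deltaFun (τ η q u : ℂ) : ℂ :=
  theta τ (u - q) * theta τ (u - q + η) / (theta τ q * theta τ (q - η))

/-! The matrix units `E_{ij}`, the basis vectors `e₁, e₂, e₃` of `V` being indexed by `0, 1, 2`. -/

abbrev E₁₁ : Matrix (Fin 3) (Fin 3) ℂ := Matrix.single 0 0 1
abbrev E₁₂ : Matrix (Fin 3) (Fin 3) ℂ := Matrix.single 0 1 1
abbrev E₁₃ : Matrix (Fin 3) (Fin 3) ℂ := Matrix.single 0 2 1
abbrev E₂₁ : Matrix (Fin 3) (Fin 3) ℂ := Matrix.single 1 0 1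
abbrev E₂₂ : Matrix (Fin 3) (Fin 3) ℂ := Matrix.single 1 1 1
abbrev E₂₃ : Matrix (Fin 3) (Fin 3) ℂ := Matrix.single 1 2 1
abbrev E₃₁ : Matrix (Fin 3) (Fin 3) ℂ := Matrix.single 2 0 1
abbrev E₃₂ : Matrix (Fin 3) (Fin 3) ℂ := Matrix.single 2 1 1
abbrev E₃₃ : Matrix (Fin 3) (Fin 3) ℂ := Matrix.single 2 2 1

/-- The R-matrix `R(q, u)` on `V ⊗ V`, `V = ℂ³`, in the basis `e_i ⊗ e_j`. -/
def RMat (τ η q u : ℂ) : Matrix (Fin 3 × Fin 3) (Fin 3 × Fin 3) ℂ :=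
  gFun τ η u • (E₁₁ ⊗ₖ E₁₁) + gFun τ η u • (E₃₃ ⊗ₖ E₃₃) + epsFun τ η q u • (E₂₂ ⊗ₖ E₂₂)
  + alphaFun τ η η q u • (E₁₂ ⊗ₖ E₂₁) + alphaFun τ η q η u • (E₂₁ ⊗ₖ E₁₂)
  + alphaFun τ η (-q) η u • (E₂₃ ⊗ₖ E₃₂) + alphaFun τ η η (-q) u • (E₃₂ ⊗ₖ E₂₃)
  + betaFun τ η η q u • (E₁₁ ⊗ₖ E₂₂) + betaFun τ η q η u • (E₂₂ ⊗ₖ E₁₁)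
  + betaFun τ η (-q) η u • (E₂₂ ⊗ₖ E₃₃) + betaFun τ η η (-q) u • (E₃₃ ⊗ₖ E₂₂)
  + gammaFun τ η (-q) q u • (E₁₁ ⊗ₖ E₃₃) + gammaFun τ η (-q) η u • (E₁₂ ⊗ₖ E₃₂)
  - gammaFun τ η η q u • (E₂₁ ⊗ₖ E₂₃)
  + gammaFun τ η q (-q) u • (E₃₃ ⊗ₖ E₁₁) + gammaFun τ η q η u • (E₃₂ ⊗ₖ E₁₂)
  - gammaFun τ η η (-q) u • (E₂₃ ⊗ₖ E₂₁)
  + deltaFun τ η q u • (E₃₁ ⊗ₖ E₁₃) + deltaFun τ η (-q) u • (E₁₃ ⊗ₖ E₃₁)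

/-- The diagonal entries (weights) of `h = E₁₁ - E₃₃` on `V`. -/
def hV : Fin 3 → ℂ := ![1, 0, -1]

/-! ## Meromorphic functions of two variables

A meromorphic function is represented by a total function; its values on the (thin) locus where a
local denominator vanishes are irrelevant. -/

/-- `f` is meromorphic on `ℂ²`: near every point it is a quotient of analytic functions, the
denominator not vanishing identically near that point. -/
def Meromorphic₂ (f : ℂ × ℂ → ℂ) : Prop :=
  ∀ p : ℂ × ℂ, ∃ g d : ℂ × ℂ → ℂ, AnalyticAt ℂ g p ∧ AnalyticAt ℂ d p ∧
    (¬ ∀ᶠ z in 𝓝 p, d z = 0) ∧ ∀ᶠ z in 𝓝 p, d z ≠ 0 → f z = g z / d z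

/-- `f(q, u)` can be restricted to the line `u = u₀` as a meromorphic function of `q`, i.e. the line
is not contained in the polar locus: near every point of the line, `f` is a quotient of analytic
functions whose denominator does not vanish identically on the line near that point. -/
def RegularAlong (u₀ : ℂ) (f : ℂ × ℂ → ℂ) : Prop :=
  ∀ q₀ : ℂ, ∃ g d : ℂ × ℂ → ℂ, AnalyticAt ℂ g (q₀, u₀) ∧ AnalyticAt ℂ d (q₀, u₀) ∧
    (¬ ∀ᶠ q in 𝓝 q₀, d (q, u₀) = 0) ∧ ∀ᶠ z in 𝓝 (q₀, u₀), d z ≠ 0 → f z = g z / d z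

/-! A vector-valued meromorphic function (with values in a complex vector space of arbitrary
dimension) is a finite sum of scalar meromorphic functions times constant vectors. -/

section VectorValued

variable {W : Type*} [AddCommGroup W] [Module ℂ W]

def VecMeromorphic₂ (f : ℂ × ℂ → W) : Prop :=
  f ∈ Submodule.span ℂ {F : ℂ × ℂ → W | ∃ (m : ℂ × ℂ → ℂ) (w : W),
    Meromorphic₂ m ∧ F = fun p => m p • w}

def VecRegularAlong (u₀ : ℂ) (f : ℂ × ℂ → W) : Prop :=
  f ∈ Submodule.span ℂ {F : ℂ × ℂ → W | ∃ (m : ℂ × ℂ → ℂ) (w : W),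
    Meromorphic₂ m ∧ RegularAlong u₀ m ∧ F = fun p => m p • w}

/-- `Fun(W)`: the `W`-valued meromorphic functions of `q ∈ ℂ`, two of them being identified when
they agree outside a closed discrete set. -/
def Fun (W : Type*) [AddCommGroup W] [Module ℂ W] : Submodule ℂ (Germ (codiscrete ℂ) W) :=
  Submodule.span ℂ {F | ∃ (m : ℂ → ℂ) (w : W), Meromorphic m ∧
    F = ((fun q => m q • w : ℂ → W) : Germ (codiscrete ℂ) W)}

/-! ## Diagonalizable modules and dynamical shifts -/

/-- The decomposition `⨁ W[μ] ≃ W` of a diagonalizable module. -/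
def weightEquiv (h : Module.End ℂ W) (hd : DirectSum.IsInternal (fun μ : ℂ => h.eigenspace μ)) :
    DirectSum ℂ (fun μ : ℂ => h.eigenspace μ) ≃ₗ[ℂ] W :=
  LinearEquiv.ofBijective (DirectSum.coeLinearMap (fun μ : ℂ => h.eigenspace μ)) (by exact hd)

/-- For a diagonalizable endomorphism `h` of `W` and a function `φ`, the operator `φ(h)` acting
on the weight space `W[μ]` as multiplication by `φ μ`. -/
def funOf (h : Module.End ℂ W) (hd : DirectSum.IsInternal (fun μ : ℂ => h.eigenspace μ))
    (φ : ℂ → ℂ) : Module.End ℂ W :=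
  DirectSum.coeLinearMap (fun μ : ℂ => h.eigenspace μ)
    ∘ₗ DirectSum.lmap (fun μ : ℂ => φ μ • (LinearMap.id : h.eigenspace μ →ₗ[ℂ] h.eigenspace μ))
    ∘ₗ (weightEquiv h hd).symm.toLinearMap

theorem funOf_apply (h : Module.End ℂ W)
    (hd : DirectSum.IsInternal (fun μ : ℂ => h.eigenspace μ)) (φ : ℂ → ℂ) (μ : ℂ) (w : W)
    (hw : w ∈ h.eigenspace μ) : funOf h hd φ w = φ μ • w := by
  have key : (weightEquiv h hd).symm w
      = DirectSum.lof ℂ ℂ (fun μ : ℂ => h.eigenspace μ) μ ⟨w, hw⟩ := by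
    rw [LinearEquiv.symm_apply_eq]
    exact (DirectSum.coeLinearMap_lof (fun μ : ℂ => h.eigenspace μ) μ ⟨w, hw⟩).symm
  simp only [funOf, LinearMap.comp_apply, LinearEquiv.coe_coe]
  rw [key, DirectSum.lmap_lof, DirectSum.coeLinearMap_lof]
  simp

/-- The operator `R₁₂(q - 2 η h₃, u)` on `V ⊗ V ⊗ W`, as a matrix with entries in `End W`:
on `V ⊗ V ⊗ W[μ]` it is `R(q - 2 η μ, u) ⊗ 1`. -/
def R12Shift (τ η : ℂ) (h : Module.End ℂ W)
    (hd : DirectSum.IsInternal (fun μ : ℂ => h.eigenspace μ)) (q u : ℂ) :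
    Matrix (Fin 3 × Fin 3) (Fin 3 × Fin 3) (Module.End ℂ W) :=
  Matrix.of fun a b => funOf h hd fun μ => RMat τ η (q - 2 * η * μ) u a b

/-- The operator `R₁₂(q, u)` on `V ⊗ V ⊗ W`. -/
def R12 (W : Type*) [AddCommGroup W] [Module ℂ W] (τ η q u : ℂ) :
    Matrix (Fin 3 × Fin 3) (Fin 3 × Fin 3) (Module.End ℂ W) :=
  (RMat τ η q u).map (algebraMap ℂ (Module.End ℂ W))

/-- For `ℒ(q) ∈ End(V ⊗ W)`, written as a `3 × 3` matrix over `End W`, the operator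
`ℒ₁₃(q - s h₂)` on `V ⊗ V ⊗ W`. -/
def leg13 (ℒ : ℂ → Matrix (Fin 3) (Fin 3) (Module.End ℂ W)) (q s : ℂ) :
    Matrix (Fin 3 × Fin 3) (Fin 3 × Fin 3) (Module.End ℂ W) :=
  Matrix.of fun a b => if a.2 = b.2 then ℒ (q - s * hV b.2) a.1 b.1 else 0

/-- The operator `ℒ₂₃(q - s h₁)` on `V ⊗ V ⊗ W`. -/
def leg23 (ℒ : ℂ → Matrix (Fin 3) (Fin 3) (Module.End ℂ W)) (q s : ℂ) :
    Matrix (Fin 3 × Fin 3) (Fin 3 × Fin 3) (Module.End ℂ W) :=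
  Matrix.of fun a b => if a.1 = b.1 then ℒ (q - s * hV b.1) a.2 b.2 else 0

/-- `h_V ⊗ 1 + 1 ⊗ h_W` on `V ⊗ W`. -/
def totalWeight (h : Module.End ℂ W) : Matrix (Fin 3) (Fin 3) (Module.End ℂ W) :=
  Matrix.diagonal fun i => algebraMap ℂ (Module.End ℂ W) (hV i) + h

end VectorValued

/-! ## Representations -/

/-- A representation of `E_{τ,η}(so₃)` on `W`: a diagonalizable `ℂh`-module structure on `W` and a
meromorphic function `ℒ(q, u)` with values in `End(V ⊗ W)`, i.e. in `3 × 3` matrices over `End W`,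
which has zero weight and satisfies the dynamical RLL relation. Both are identities of meromorphic
functions; they are required, on every vector, off a meagre set of parameters, which avoids the
irrelevant values at poles. -/
structure Representation (τ η : ℂ) (W : Type*) [AddCommGroup W] [Module ℂ W] where
  h : Module.End ℂ W
  diagonalizable : DirectSum.IsInternal (fun μ : ℂ => h.eigenspace μ)
  ℒ : ℂ → ℂ → Matrix (Fin 3) (Fin 3) (Module.End ℂ W)
  meromorphic : ∀ (i j : Fin 3) (w : W), VecMeromorphic₂ fun p : ℂ × ℂ => ℒ p.1 p.2 i j w
  zero_weight : ∀ (i j : Fin 3) (w : W), ∀ᶠ p : ℂ × ℂ in residual (ℂ × ℂ),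
    (totalWeight h * ℒ p.1 p.2) i j w = (ℒ p.1 p.2 * totalWeight h) i j w
  rll : ∀ (a b : Fin 3 × Fin 3) (w : W), ∀ᶠ p : ℂ × ℂ × ℂ in residual (ℂ × ℂ × ℂ),
    let q := p.1
    let u₁ := p.2.1
    let u₂ := p.2.2
    (R12Shift τ η h diagonalizable q (u₁ - u₂) * leg13 (fun x => ℒ x u₁) q 0
        * leg23 (fun x => ℒ x u₂) q (2 * η)) a b w
      = (leg23 (fun x => ℒ x u₂) q 0 * leg13 (fun x => ℒ x u₁) q (2 * η)
        * R12 W τ η q (u₁ - u₂)) a b w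

/-- The operator `f ↦ (q ↦ A(q) f(q - s))` on functions modulo closed discrete sets. -/
def shiftOp {W : Type*} [AddCommGroup W] [Module ℂ W] (A : ℂ → Module.End ℂ W) (s : ℂ) :
    Module.End ℂ (Germ (codiscrete ℂ) W) where
  toFun := Germ.map' (fun f q => A q (f (q - s))) (by
    intro f g hfg
    have ht : Tendsto (fun q : ℂ => q - s) (codiscrete ℂ) (codiscrete ℂ) := by
      intro S hS
      rw [mem_codiscrete'] at hS
      rw [mem_map, mem_codiscrete']
      refine ⟨hS.1.preimage (by fun_prop), ?_⟩
      have := hS.2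
      rw [← Set.preimage_compl]
      exact this.preimage (by fun_prop) sub_left_injective
    filter_upwards [ht.eventually hfg] with q hq
    simp only [hq])
  map_add' F G := by
    induction F using Germ.inductionOn
    induction G using Germ.inductionOn
    rename_i f g
    refine Germ.coe_eq.2 (Eventually.of_forall fun q => ?_)
    simp
  map_smul' c F := by
    induction F using Germ.inductionOn
    rename_i f
    refine Germ.coe_eq.2 (Eventually.of_forall fun q => ?_)
    simp

namespace Representation

variable {τ η : ℂ} {W : Type*} [AddCommGroup W] [Module ℂ W]

/-- The spectral parameter `u` is regular: `ℒ(·, u)` is defined as a meromorphic function of `q`,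
that is, the line of constant `u` is not contained in the polar locus. -/
def IsRegular (ρ : Representation τ η W) (u : ℂ) : Prop :=
  ∀ (i j : Fin 3) (w : W), VecRegularAlong u fun p : ℂ × ℂ => ρ.ℒ p.1 p.2 i j w

/-- `L(u) = ℒ(q, u) e^{-2 η h ∂_q}` with `h` acting on `V`: a `3 × 3` matrix of operators on
functions of `q`, whose `(i, j)` entry is `f ↦ (q ↦ ℒ_{ij}(q, u) f(q - 2 η h_j))`. -/
def L (ρ : Representation τ η W) (u : ℂ) :
    Matrix (Fin 3) (Fin 3) (Module.End ℂ (Germ (codiscrete ℂ) W)) :=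
  Matrix.of fun i j => shiftOp (fun q => ρ.ℒ q u i j) (2 * η * hV j)

/-- The transfer matrix `t(u) = Tr L(u)`, the trace being taken over `V`. -/
def transfer (ρ : Representation τ η W) (u : ℂ) : Module.End ℂ (Germ (codiscrete ℂ) W) :=
  (ρ.L u).trace

/-- `Fun(W)[0]`: the meromorphic functions with values in the zero weight subspace `W[0]`. -/
def FunZero (ρ : Representation τ η W) : Submodule ℂ (Germ (codiscrete ℂ) W) where
  carrier := {F | F ∈ Fun W ∧ F.LiftPred (· ∈ ρ.h.eigenspace 0)}
  add_mem' := by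
    rintro F G ⟨hF, hF'⟩ ⟨hG, hG'⟩
    refine ⟨add_mem hF hG, ?_⟩
    induction F using Germ.inductionOn
    induction G using Germ.inductionOn
    rw [Germ.liftPred_coe] at hF' hG'
    refine Germ.liftPred_coe.2 ?_
    filter_upwards [hF', hG'] with q h₁ h₂
    exact add_mem h₁ h₂
  zero_mem' := ⟨zero_mem _, Germ.liftPred_const (zero_mem _)⟩
  smul_mem' := by
    rintro c F ⟨hF, hF'⟩
    refine ⟨Submodule.smul_mem _ c hF, ?_⟩
    induction F using Germ.inductionOn
    rw [Germ.liftPred_coe] at hF'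
    refine Germ.liftPred_coe.2 ?_
    filter_upwards [hF'] with q h₁
    exact Submodule.smul_mem _ c h₁

end Representation

end EllipticSO3

end

namespace EllipticSO3

/-! On a vector of W[0] the dynamical shift drops out of the RLL relation. Between indices of equal
weight in V ⊗ V, the product of two ℒ-entries sends W[0] to W[0], so R(q - 2ηh₃, u₁ - u₂) acts there
as the scalar matrix R(q, u₁ - u₂), and R vanishes between different weights. After pairing with a
linear functional of W, RLL reads Rt = sR on each weight block. Where R is invertible, t and s have
the same trace over every weight block (`sum_diag_eq_of_intertwines`, `trace_dynMul_eq`). R is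
generically invertible because R(q, 0) is the flip of the tensor factors (`RMat_zero`). The block
traces suffice: in t(u)t(v) applied to m(q)w, the scalar m is shifted by 2η times the weight of e_i
⊗ e_j, hence by a constant on each block. These identities hold off a meagre set of (q, u₁, u₂).
Regularity gives weak continuity at (q, u, v) for all q off a closed discrete set, and since R no
longer occurs in the trace identity, it extends to every pair of regular u, v
(`trace_dynMul_eq_of_isRegular`). -/

/-! ### The theta function and invertibility of R -/

theorem theta_eq_jacobiTheta₂ (τ u : ℂ) :
    theta τ u = -(Complex.exp (Real.pi * Complex.I * (τ / 4 + u + 1 / 2))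
      * jacobiTheta₂ (u + 1 / 2 + τ / 2) τ) := by
  rw [theta, jacobiTheta₂, ← tsum_mul_left]
  congr 1
  refine tsum_congr fun j => ?_
  rw [jacobiTheta₂_term, ← Complex.exp_add]
  congr 1
  ring

theorem differentiable_theta {τ : ℂ} (hτ : 0 < τ.im) : Differentiable ℂ (theta τ) := by
  have h : theta τ = fun u => -(Complex.exp (Real.pi * Complex.I * (τ / 4 + u + 1 / 2))
      * jacobiTheta₂ (u + 1 / 2 + τ / 2) τ) := funext (theta_eq_jacobiTheta₂ τ)
  rw [h]
  intro u
  have h₁ : DifferentiableAt ℂ (fun u : ℂ => jacobiTheta₂ (u + 1 / 2 + τ / 2) τ) u :=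
    (differentiableAt_jacobiTheta₂_fst (u + 1 / 2 + τ / 2) hτ).comp u
      (f := fun u : ℂ => u + 1 / 2 + τ / 2) (by fun_prop)
  fun_prop

theorem theta_neg (τ u : ℂ) : theta τ (-u) = -theta τ u := by
  rw [theta, theta, neg_neg, ← tsum_neg,
    -- The reindexing j ↦ -1 - j negates j + 1/2; the half-period 1/2 in the argument then
    -- contributes exp(πi(2j + 1)) = -1.
    ← ((Equiv.addRight (1 : ℤ)).trans (Equiv.neg ℤ)).tsum_eq]
  refine tsum_congr fun j => ?_
  have : Complex.exp (Real.pi * Complex.I * (2 * j + 1)) = -1 := by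
    rw [show (Real.pi : ℂ) * Complex.I * (2 * j + 1)
      = (j : ℂ) * (2 * Real.pi * Complex.I) + Real.pi * Complex.I by ring,
      Complex.exp_add, Complex.exp_int_mul_two_pi_mul_I, Complex.exp_pi_mul_I, one_mul]
  rw [← neg_one_mul (Complex.exp _), ← this, ← Complex.exp_add]
  congr 1
  simp
  ring

/-- The weight of `e_i ⊗ e_j` in `V ⊗ V`. -/
def weight (a : Fin 3 × Fin 3) : ℂ := hV a.1 + hV a.2

theorem RMat_eq_zero_of_weight_ne (τ η q u : ℂ) {a b : Fin 3 × Fin 3} (h : weight a ≠ weight b) :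
    RMat τ η q u a b = 0 := by
  revert h
  obtain ⟨a₁, a₂⟩ := a
  obtain ⟨b₁, b₂⟩ := b
  fin_cases a₁ <;> fin_cases a₂ <;> fin_cases b₁ <;> fin_cases b₂ <;>
    simp [weight, hV, RMat, Matrix.kroneckerMap_apply]

/-- The parameters `q` at which the R-matrix has no pole. -/
def nonpolar (τ η : ℂ) : Set ℂ :=
  {q | theta τ q ≠ 0 ∧ theta τ (q - η) ≠ 0 ∧ theta τ (q + η) ≠ 0}

theorem theta_neg_ne_zero {τ u v : ℂ} (h : v = -u) (hu : theta τ u ≠ 0) : theta τ v ≠ 0 := by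
  rw [h, theta_neg]; exact neg_ne_zero.2 hu

/-- Since ϑ is odd, ϑ(0) = 0 kills β and γ at u = 0, while g, ε, α and δ become 1; what is left is
the flip. -/
theorem RMat_zero {τ η : ℂ} (hη : theta τ η ≠ 0) (hη' : theta τ (2 * η) ≠ 0)
    {q : ℂ} (hq : q ∈ nonpolar τ η) :
    RMat τ η q 0 = (Equiv.prodComm (Fin 3) (Fin 3)).toPEquiv.toMatrix := by
  obtain ⟨h₀, h₁, h₂⟩ := hq
  have h₃ : theta τ 0 = 0 := by simpa [self_eq_neg] using theta_neg τ 0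
  have e₁ : theta τ (η - q) = -theta τ (q - η) := by rw [← theta_neg]; congr 1; ring
  have e₂ : theta τ (-q - η) = -theta τ (q + η) := by rw [← theta_neg]; congr 1; ring
  have e₃ : theta τ (-q + η) = -theta τ (q - η) := by rw [← theta_neg]; congr 1; ring
  have e₄ : theta τ (η + q) = theta τ (q + η) := by rw [add_comm]
  have hg : gFun τ η 0 = 1 := by
    simp [gFun, theta_neg, hη, hη']
  have hε : epsFun τ η q 0 = 1 := by simp [epsFun, h₃, hη, hη']
  have hα₁ : alphaFun τ η η q 0 = 1 := by simp [alphaFun, e₁, hη, h₁]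
  have hα₂ : alphaFun τ η q η 0 = 1 := by simp [alphaFun, hη, h₁]
  have hα₃ : alphaFun τ η (-q) η 0 = 1 := by simp [alphaFun, e₂, hη, h₂]
  have hα₄ : alphaFun τ η η (-q) 0 = 1 := by simp [alphaFun, e₄, hη, h₂]
  have hβ (x y : ℂ) : betaFun τ η x y 0 = 0 := by simp [betaFun, h₃]
  have hγ (x y : ℂ) : gammaFun τ η x y 0 = 0 := by simp [gammaFun, h₃]
  have hδ₁ : deltaFun τ η q 0 = 1 := by simp [deltaFun, theta_neg, e₃, h₀, h₁]
  have hδ₂ : deltaFun τ η (-q) 0 = 1 := by simp [deltaFun, theta_neg, e₂, h₀, h₂]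
  ext ⟨a₁, a₂⟩ ⟨b₁, b₂⟩
  rw [RMat, hg, hε, hα₁, hα₂, hα₃, hα₄, hβ, hβ, hβ, hβ, hγ, hγ, hγ, hγ, hγ, hγ, hδ₁, hδ₂]
  fin_cases a₁ <;> fin_cases a₂ <;> fin_cases b₁ <;> fin_cases b₂ <;>
    simp [Matrix.kroneckerMap_apply, PEquiv.toMatrix_apply]

theorem det_RMat_zero_ne_zero {τ η : ℂ} (hη : theta τ η ≠ 0) (hη' : theta τ (2 * η) ≠ 0)
    {q : ℂ} (hq : q ∈ nonpolar τ η) : (RMat τ η q 0).det ≠ 0 := by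
  rw [RMat_zero hη hη' hq, Matrix.det_permutation]
  simp

theorem continuousAt_RMat {τ η : ℂ} (hη : theta τ η ≠ 0) (hη' : theta τ (2 * η) ≠ 0)
    (hτ : 0 < τ.im) {q : ℂ} (hq : q ∈ nonpolar τ η) (u : ℂ) :
    ContinuousAt (fun p : ℂ × ℂ => RMat τ η p.1 p.2) (q, u) := by
  have hθ : Continuous (theta τ) := (differentiable_theta hτ).continuous
  obtain ⟨h₀, h₁, h₂⟩ := hq
  have hη₂ : theta τ (-2 * η) ≠ 0 := theta_neg_ne_zero (by ring) hη'
  have hη₃ : theta τ (-(2 * η)) ≠ 0 := theta_neg_ne_zero (by ring) hη'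
  have h₃ : theta τ (η - q) ≠ 0 := theta_neg_ne_zero (by ring) h₁
  have h₄ : theta τ (-q - η) ≠ 0 := theta_neg_ne_zero (by ring) h₂
  have h₅ : theta τ (-q + η) ≠ 0 := theta_neg_ne_zero (by ring) h₁
  have h₆ : theta τ (η + q) ≠ 0 := by rwa [add_comm]
  have h₇ : theta τ (-q) ≠ 0 := theta_neg_ne_zero rfl h₀
  have c {f : ℂ × ℂ → ℂ} (hf : Continuous f) : ContinuousAt (fun p => theta τ (f p)) (q, u) :=
    (hθ.comp hf).continuousAt
  have hg : ContinuousAt (fun p : ℂ × ℂ => gFun τ η p.2) (q, u) := by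
    unfold gFun; fun_prop
  have hε : ContinuousAt (fun p : ℂ × ℂ => epsFun τ η p.1 p.2) (q, u) := by
    unfold epsFun; fun_prop (disch := simp [*])
  have hα₁ : ContinuousAt (fun p : ℂ × ℂ => alphaFun τ η η p.1 p.2) (q, u) := by
    unfold alphaFun; fun_prop (disch := simp [*])
  have hα₂ : ContinuousAt (fun p : ℂ × ℂ => alphaFun τ η p.1 η p.2) (q, u) := by
    unfold alphaFun; fun_prop (disch := simp [*])
  have hα₃ : ContinuousAt (fun p : ℂ × ℂ => alphaFun τ η (-p.1) η p.2) (q, u) := by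
    unfold alphaFun; fun_prop (disch := simp [*])
  have hα₄ : ContinuousAt (fun p : ℂ × ℂ => alphaFun τ η η (-p.1) p.2) (q, u) := by
    unfold alphaFun; fun_prop (disch := simp [*])
  have hβ₁ : ContinuousAt (fun p : ℂ × ℂ => betaFun τ η η p.1 p.2) (q, u) := by
    unfold betaFun; fun_prop (disch := simp [*])
  have hβ₂ : ContinuousAt (fun p : ℂ × ℂ => betaFun τ η p.1 η p.2) (q, u) := by
    unfold betaFun; fun_prop (disch := simp [*])
  have hβ₃ : ContinuousAt (fun p : ℂ × ℂ => betaFun τ η (-p.1) η p.2) (q, u) := by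
    unfold betaFun; fun_prop (disch := simp [*])
  have hβ₄ : ContinuousAt (fun p : ℂ × ℂ => betaFun τ η η (-p.1) p.2) (q, u) := by
    unfold betaFun; fun_prop (disch := simp [*])
  -- Denominators of γ at the arguments used in R: ϑ(q₁ + q₂ - 2η) with one argument η and the other
  -- ±q, and ϑ(q₁ + η) at q₁ = η.
  have e₁ : theta τ (-q + η - 2 * η) ≠ 0 := by convert h₄ using 2; ring
  have e₂ : theta τ (q + η - 2 * η) ≠ 0 := by convert h₁ using 2; ring
  have e₃ : theta τ (η + q - 2 * η) ≠ 0 := by convert h₁ using 2; ring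
  have e₄ : theta τ (η + -q - 2 * η) ≠ 0 := by convert h₄ using 2; ring
  have e₅ : theta τ (η + η) ≠ 0 := by rwa [← two_mul]
  have hγ₁ : ContinuousAt (fun p : ℂ × ℂ => gammaFun τ η (-p.1) p.1 p.2) (q, u) := by
    unfold gammaFun; fun_prop (disch := simp [*])
  have hγ₂ : ContinuousAt (fun p : ℂ × ℂ => gammaFun τ η (-p.1) η p.2) (q, u) := by
    unfold gammaFun; fun_prop (disch := simp [*])
  have hγ₃ : ContinuousAt (fun p : ℂ × ℂ => gammaFun τ η η p.1 p.2) (q, u) := by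
    unfold gammaFun; fun_prop (disch := simp [*])
  have hγ₄ : ContinuousAt (fun p : ℂ × ℂ => gammaFun τ η p.1 (-p.1) p.2) (q, u) := by
    unfold gammaFun; fun_prop (disch := simp [*])
  have hγ₅ : ContinuousAt (fun p : ℂ × ℂ => gammaFun τ η p.1 η p.2) (q, u) := by
    unfold gammaFun; fun_prop (disch := simp [*])
  have hγ₆ : ContinuousAt (fun p : ℂ × ℂ => gammaFun τ η η (-p.1) p.2) (q, u) := by
    unfold gammaFun; fun_prop (disch := simp [*])
  have hδ₁ : ContinuousAt (fun p : ℂ × ℂ => deltaFun τ η p.1 p.2) (q, u) := by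
    unfold deltaFun; fun_prop (disch := simp [*])
  have hδ₂ : ContinuousAt (fun p : ℂ × ℂ => deltaFun τ η (-p.1) p.2) (q, u) := by
    unfold deltaFun; fun_prop (disch := simp [*])
  unfold RMat
  fun_prop

/-- All denominators are constant in u, so no condition on q is needed, even with the convention x/0
= 0. -/
theorem differentiable_det_RMat {τ : ℂ} (hτ : 0 < τ.im) (η q : ℂ) :
    Differentiable ℂ (fun u => (RMat τ η q u).det) := by
  have hθ := differentiable_theta hτ
  have c {f : ℂ → ℂ} (hf : Differentiable ℂ f) : Differentiable ℂ (fun u => theta τ (f u)) :=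
    hθ.comp hf
  have hg : Differentiable ℂ (gFun τ η) := by
    unfold gFun; fun_prop
  have hε : Differentiable ℂ (epsFun τ η q) := by
    unfold epsFun; fun_prop
  have hα (x y : ℂ) : Differentiable ℂ (alphaFun τ η x y) := by
    unfold alphaFun; fun_prop
  have hβ (x y : ℂ) : Differentiable ℂ (betaFun τ η x y) := by
    unfold betaFun; fun_prop
  have hγ (x y : ℂ) : Differentiable ℂ (gammaFun τ η x y) := by
    unfold gammaFun; fun_prop
  have hδ (x : ℂ) : Differentiable ℂ (deltaFun τ η x) := by
    unfold deltaFun; fun_prop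
  have hR (a b : Fin 3 × Fin 3) : Differentiable ℂ (fun u => RMat τ η q u a b) := by
    simp only [RMat, Matrix.add_apply, Matrix.sub_apply, Matrix.smul_apply, smul_eq_mul]
    fun_prop
  simp only [Matrix.det_apply]
  exact Differentiable.fun_sum fun σ _ => (Differentiable.fun_finsetProd fun a _ => hR _ _).const_smul _

/-! ### Generic parameters -/

theorem eventually_codiscrete_iff {X : Type*} [TopologicalSpace X] {p : X → Prop} :
    (∀ᶠ x in codiscrete X, p x) ↔ ∀ x, ∀ᶠ y in 𝓝[≠] x, p y := by
  simp [codiscrete, codiscreteWithin, eventually_iSup, Set.compl_eq_univ_sdiff]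

theorem dense_ne_zero {f : ℂ → ℂ} (hf : Differentiable ℂ f) {z₀ : ℂ} (h : f z₀ ≠ 0) :
    Dense {z | f z ≠ 0} := by
  have ha : AnalyticOnNhd ℂ f Set.univ := fun z _ => hf.analyticAt z
  have hc := ha.preimage_zero_mem_codiscrete h
  rw [dense_iff_closure_eq, Set.eq_univ_iff_forall]
  intro z
  rw [mem_closure_iff_frequently]
  have : ∀ᶠ y in 𝓝[≠] z, f y ≠ 0 := eventually_codiscrete_iff.1 hc z
  exact this.frequently.filter_mono nhdsWithin_le_nhds

theorem continuousAt_det {X n : Type*} [TopologicalSpace X] [Fintype n] [DecidableEq n]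
    {f : X → Matrix n n ℂ} {x : X} (hf : ContinuousAt f x) : ContinuousAt (fun y => (f y).det) x :=
  ContinuousAt.comp (g := Matrix.det) continuous_id.matrix_det.continuousAt hf

theorem nonpolar_dense_open {τ η : ℂ} (hτ : 0 < τ.im) (hη : theta τ η ≠ 0) :
    IsOpen (nonpolar τ η) ∧ Dense (nonpolar τ η) := by
  have hθ := differentiable_theta hτ
  have c {f : ℂ → ℂ} (hf : Differentiable ℂ f) : Differentiable ℂ (fun u => theta τ (f u)) :=
    hθ.comp hf
  have hf : Differentiable ℂ (fun q => theta τ (q - η)) := by fun_prop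
  have hg : Differentiable ℂ (fun q => theta τ (q + η)) := by fun_prop
  have o₀ := isOpen_ne_fun hθ.continuous (continuous_const (y := (0 : ℂ)))
  have o₁ := isOpen_ne_fun hf.continuous (continuous_const (y := (0 : ℂ)))
  have o₂ := isOpen_ne_fun hg.continuous (continuous_const (y := (0 : ℂ)))
  -- At q = η, 2η and 0 the functions ϑ(q), ϑ(q - η) and ϑ(q + η) all take the value ϑ(η) ≠ 0.
  refine ⟨o₀.inter (o₁.inter o₂), (dense_ne_zero hθ hη).inter_of_isOpen_left
    ((dense_ne_zero hf (z₀ := 2 * η) ?_).inter_of_isOpen_left (dense_ne_zero hg (z₀ := 0) ?_) o₁) o₀⟩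
  · convert hη using 2; ring
  · simpa using hη

/-- Openness comes from joint continuity of R off its poles. For density, first move q off the
poles, then move u: the determinant is entire in u and nonzero at u = 0. -/
theorem eventually_residual_det_RMat_ne_zero {τ η : ℂ} (hτ : 0 < τ.im) (hη : theta τ η ≠ 0)
    (hη' : theta τ (2 * η) ≠ 0) :
    ∀ᶠ p : ℂ × ℂ in residual (ℂ × ℂ), (RMat τ η p.1 p.2).det ≠ 0 := by
  obtain ⟨ho, hd⟩ := nonpolar_dense_open hτ hη
  have hS : {p : ℂ × ℂ | p.1 ∈ nonpolar τ η ∧ (RMat τ η p.1 p.2).det ≠ 0} ∈ residual (ℂ × ℂ) := by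
    refine residual_of_dense_open ?_ ?_
    · rw [isOpen_iff_mem_nhds]
      rintro ⟨q, u⟩ ⟨hq, hu⟩
      have h₁ : ∀ᶠ p : ℂ × ℂ in 𝓝 (q, u), p.1 ∈ nonpolar τ η :=
        continuous_fst.continuousAt.eventually (ho.mem_nhds hq)
      have h₂ : ContinuousAt (fun p : ℂ × ℂ => (RMat τ η p.1 p.2).det) (q, u) :=
        continuousAt_det (f := fun p : ℂ × ℂ => RMat τ η p.1 p.2)
          (continuousAt_RMat hη hη' hτ hq u)
      exact h₁.and (h₂.eventually_ne hu)
    · rw [dense_iff_inter_open]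
      rintro U hU ⟨⟨q, u⟩, hqu⟩
      obtain ⟨A, B, hA, hB, hqA, huB, hAB⟩ := isOpen_prod_iff.1 hU q u hqu
      obtain ⟨q', hq'A, hq'⟩ := hd.inter_open_nonempty A hA ⟨q, hqA⟩
      obtain ⟨u', hu'B, hu'⟩ := (dense_ne_zero (differentiable_det_RMat hτ η q')
        (det_RMat_zero_ne_zero hη hη' hq')).inter_open_nonempty B hB ⟨u, huB⟩
      exact ⟨(q', u'), hAB ⟨hq'A, hu'B⟩, hq', hu'⟩
  filter_upwards [hS] with p hp using hp.2

/-! ### Restriction to a line of constant spectral parameter -/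

theorem tendsto_sub_codiscrete (s : ℂ) :
    Tendsto (fun q : ℂ => q - s) (codiscrete ℂ) (codiscrete ℂ) := by
  intro S hS
  rw [mem_codiscrete'] at hS
  rw [mem_map, mem_codiscrete', ← Set.preimage_compl]
  exact ⟨hS.1.preimage (by fun_prop), hS.2.preimage (by fun_prop) sub_left_injective⟩

/-- The zeros of d on the line are isolated. Away from them d is nonzero on a full two-dimensional
neighbourhood, so f has no arbitrary values there. -/
theorem RegularAlong.eventually_eq {u₀ : ℂ} {f : ℂ × ℂ → ℂ} (hf : RegularAlong u₀ f) (q₀ : ℂ) :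
    ∃ g d : ℂ × ℂ → ℂ, AnalyticAt ℂ g (q₀, u₀) ∧ AnalyticAt ℂ d (q₀, u₀) ∧
      ∀ᶠ q in 𝓝[≠] q₀, AnalyticAt ℂ g (q, u₀) ∧ AnalyticAt ℂ d (q, u₀) ∧ d (q, u₀) ≠ 0 ∧
        f =ᶠ[𝓝 (q, u₀)] fun z => g z / d z := by
  obtain ⟨g, d, hg, hd, hd₀, h⟩ := hf q₀
  refine ⟨g, d, hg, hd, ?_⟩
  have hline : ContinuousAt (fun q : ℂ => (q, u₀)) q₀ := by fun_prop
  have hd' : AnalyticAt ℂ (fun q : ℂ => d (q, u₀)) q₀ :=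
    AnalyticAt.comp (g := d) (f := fun q : ℂ => (q, u₀)) hd (by fun_prop)
  filter_upwards [hd'.eventually_eq_zero_or_eventually_ne_zero.resolve_left hd₀,
    nhdsWithin_le_nhds (hline.eventually hg.eventually_analyticAt),
    nhdsWithin_le_nhds (hline.eventually hd.eventually_analyticAt),
    nhdsWithin_le_nhds (hline.eventually h.eventually_nhds)] with q h₁ h₂ h₃ h₄
  refine ⟨h₂, h₃, h₁, ?_⟩
  filter_upwards [h₄, h₃.continuousAt.eventually_ne h₁] with z h₅ h₆ using h₅ h₆

theorem RegularAlong.eventually_continuousAt {u₀ : ℂ} {f : ℂ × ℂ → ℂ} (hf : RegularAlong u₀ f) :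
    ∀ᶠ q in codiscrete ℂ, ContinuousAt f (q, u₀) := by
  refine eventually_codiscrete_iff.2 fun q₀ => ?_
  obtain ⟨g, d, -, -, h⟩ := hf.eventually_eq q₀
  filter_upwards [h] with q ⟨hg, hd, hd₀, hfg⟩
  exact (hg.continuousAt.div₀ hd.continuousAt hd₀).congr hfg.symm

theorem RegularAlong.meromorphic {u₀ : ℂ} {f : ℂ × ℂ → ℂ} (hf : RegularAlong u₀ f) :
    Meromorphic fun q => f (q, u₀) := by
  intro q₀
  obtain ⟨g, d, hg, hd, h⟩ := hf.eventually_eq q₀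
  have hg' : AnalyticAt ℂ (fun q : ℂ => g (q, u₀)) q₀ :=
    AnalyticAt.comp (g := g) (f := fun q : ℂ => (q, u₀)) hg (by fun_prop)
  have hd' : AnalyticAt ℂ (fun q : ℂ => d (q, u₀)) q₀ :=
    AnalyticAt.comp (g := d) (f := fun q : ℂ => (q, u₀)) hd (by fun_prop)
  refine (hg'.meromorphicAt.div hd'.meromorphicAt).congr ?_
  filter_upwards [h] with q ⟨_, _, _, hfg⟩
  exact hfg.eq_of_nhds.symm

/-! ### Vector-valued functions, weak continuity, weight projections -/

section VectorValued

variable {W : Type*} [AddCommGroup W] [Module ℂ W]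

theorem VecMeromorphic₂.exists_finset {f : ℂ × ℂ → W} (hf : VecMeromorphic₂ f) :
    ∃ s : Finset W, ∀ p, f p ∈ Submodule.span ℂ (s : Set W) := by
  classical
  induction hf using Submodule.span_induction with
  | mem F hF =>
    obtain ⟨m, w, -, rfl⟩ := hF
    exact ⟨{w}, fun p => Submodule.smul_mem _ _ (Submodule.subset_span (by simp))⟩
  | zero => exact ⟨∅, fun p => zero_mem _⟩
  | add F G _ _ hF hG =>
    obtain ⟨s, hs⟩ := hF
    obtain ⟨t, ht⟩ := hG
    refine ⟨s ∪ t, fun p => add_mem (Submodule.span_mono ?_ (hs p)) (Submodule.span_mono ?_ (ht p))⟩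
      <;> simp
  | smul c F _ hF =>
    obtain ⟨s, hs⟩ := hF
    exact ⟨s, fun p => Submodule.smul_mem _ c (hs p)⟩

/-- W carries no topology, so continuity is tested on functionals. The exceptional set comes from
finitely many scalar coefficients and is therefore independent of φ. -/
theorem VecRegularAlong.eventually_continuousAt {u₀ : ℂ} {f : ℂ × ℂ → W}
    (hf : VecRegularAlong u₀ f) :
    ∀ᶠ q in codiscrete ℂ, ∀ φ : Module.Dual ℂ W, ContinuousAt (fun p => φ (f p)) (q, u₀) := by
  induction hf using Submodule.span_induction with
  | mem F hF =>
    obtain ⟨m, w, -, hm, rfl⟩ := hF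
    filter_upwards [hm.eventually_continuousAt] with q hq φ
    simpa using hq.mul_const (φ w)
  | zero => exact Eventually.of_forall fun q φ => by simpa using continuousAt_const
  | add F G _ _ hF hG =>
    filter_upwards [hF, hG] with q h₁ h₂ φ
    simpa using ContinuousAt.fun_add (h₁ φ) (h₂ φ)
  | smul c F _ hF =>
    filter_upwards [hF] with q h₁ φ
    simpa using (h₁ φ).const_mul c

theorem smul_mem_Fun {m : ℂ → ℂ} (hm : Meromorphic m) (w : W) :
    ((fun q => m q • w : ℂ → W) : Germ (codiscrete ℂ) W) ∈ Fun W :=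
  Submodule.subset_span ⟨m, w, hm, rfl⟩

theorem VecRegularAlong.smul_mem_Fun {u₀ : ℂ} {f : ℂ × ℂ → W} (hf : VecRegularAlong u₀ f)
    {m : ℂ → ℂ} (hm : Meromorphic m) :
    ((fun q => m q • f (q, u₀) : ℂ → W) : Germ (codiscrete ℂ) W) ∈ Fun W := by
  induction hf using Submodule.span_induction with
  | mem F hF =>
    obtain ⟨n, w, -, hn, rfl⟩ := hF
    simpa [smul_smul] using EllipticSO3.smul_mem_Fun (hm.mul hn.meromorphic) w
  | zero =>
    simp only [Pi.zero_apply, smul_zero]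
    exact zero_mem (Fun W)
  | add F G _ _ hF hG =>
    simp only [Pi.add_apply, smul_add]
    exact add_mem hF hG
  | smul c F _ hF =>
    simp only [Pi.smul_apply, smul_comm _ c]
    exact Submodule.smul_mem _ c hF

theorem shiftOp_coe (A : ℂ → Module.End ℂ W) (s : ℂ) (f : ℂ → W) :
    shiftOp A s (f : Germ (codiscrete ℂ) W)
      = ((fun q => A q (f (q - s)) : ℂ → W) : Germ (codiscrete ℂ) W) := rfl

theorem meromorphic_comp_sub {m : ℂ → ℂ} (hm : Meromorphic m) (s : ℂ) :
    Meromorphic fun q => m (q - s) := fun q =>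
  (hm (q - s)).comp_analyticAt (f := m) (g := fun q => q - s) (by fun_prop)

/-- Two functions of three variables that agree off a meagre set agree at each point at which both
are weakly continuous. -/
theorem eq_of_eventually_residual {X : Type*} [TopologicalSpace X] [BaireSpace X] {F G : X → W}
    (h : ∀ᶠ x in residual X, F x = G x) {x : X}
    (hF : ∀ φ : Module.Dual ℂ W, ContinuousAt (fun y => φ (F y)) x)
    (hG : ∀ φ : Module.Dual ℂ W, ContinuousAt (fun y => φ (G y)) x) : F x = G x := by
  rw [← sub_eq_zero, ← Module.forall_dual_apply_eq_zero_iff ℂ]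
  intro φ
  rw [map_sub, sub_eq_zero]
  have hd : Dense {x | F x = G x} := dense_of_mem_residual h
  have : (𝓝[{x | F x = G x}] x).NeBot := mem_closure_iff_nhdsWithin_neBot.1 (hd x)
  refine tendsto_nhds_unique (l := 𝓝[{x | F x = G x}] x)
    ((hF φ).mono_left nhdsWithin_le_nhds) (((hG φ).mono_left nhdsWithin_le_nhds).congr' ?_)
  filter_upwards [self_mem_nhdsWithin] with y hy
  rw [show F y = G y from hy]

theorem funOf_zero (h : Module.End ℂ W)
    (hd : DirectSum.IsInternal (fun μ : ℂ => h.eigenspace μ)) : funOf h hd (fun _ => 0) = 0 := by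
  have h₀ : DirectSum.lmap
      (fun μ : ℂ => (0 : ℂ) • (LinearMap.id : h.eigenspace μ →ₗ[ℂ] h.eigenspace μ)) = 0 := by
    ext μ x : 2
    simp
  rw [funOf, h₀, LinearMap.zero_comp, LinearMap.comp_zero]

/-- `Pi.single 0 1` is the indicator of the eigenvalue 0, so this operator is the projection onto
W[0]. -/
theorem funOf_single_mem_eigenspace_zero (h : Module.End ℂ W)
    (hd : DirectSum.IsInternal (fun μ : ℂ => h.eigenspace μ)) (w : W) :
    funOf h hd (Pi.single 0 1) w ∈ h.eigenspace 0 := by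
  have key : ∀ x : DirectSum ℂ (fun μ : ℂ => h.eigenspace μ),
      funOf h hd (Pi.single 0 1) (weightEquiv h hd x) ∈ h.eigenspace 0 := by
    intro x
    induction x using DirectSum.induction_on with
    | zero => simp
    | of μ x =>
      have : weightEquiv h hd (DirectSum.of _ μ x) = x :=
        DirectSum.coeLinearMap_lof (fun μ : ℂ => h.eigenspace μ) μ x
      rw [this, funOf_apply h hd _ μ _ x.2]
      by_cases hμ : μ = 0
      · subst hμ
        exact Submodule.smul_mem _ _ x.2
      · simp [hμ]
    | add x y hx hy => simpa using add_mem hx hy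
  simpa using key ((weightEquiv h hd).symm w)

end VectorValued

/-! ### Traces over weight blocks -/

section Trace

variable {W : Type*} [AddCommGroup W] [Module ℂ W]

/-- If a zero-weight invertible matrix `R` intertwines two zero-weight matrices `t` and `s`, then
`t` and `s` have equal traces on every weight space. -/
theorem sum_diag_eq_of_intertwines {n : Type*} [Fintype n] [DecidableEq n] (wt : n → ℂ)
    {R t s : Matrix n n ℂ} (hR : R.det ≠ 0) (hRw : ∀ a b, wt a ≠ wt b → R a b = 0)
    (h : ∀ a b, wt a = wt b → (R * t) a b = (s * R) a b) (k : ℂ) :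
    ∑ a, (if wt a = k then t a a else 0) = ∑ a, (if wt a = k then s a a else 0) := by
  set P : Matrix n n ℂ := Matrix.diagonal fun a => if wt a = k then 1 else 0 with hP
  have hPR : P * R = R * P := by
    ext a b
    rw [hP, Matrix.diagonal_mul, Matrix.mul_diagonal]
    by_cases hab : wt a = wt b
    · simp [hab]
    · simp [hRw a b hab]
  have hu : IsUnit R.det := hR.isUnit
  -- The intertwining is assumed only between equal weights; compression by P on both sides keeps
  -- only such entries.
  have hPtP : P * (R * t) * P = P * (s * R) * P := by
    ext a b
    simp only [hP, Matrix.diagonal_mul, Matrix.mul_diagonal]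
    by_cases ha : wt a = k
    · by_cases hb : wt b = k
      · rw [h a b (ha.trans hb.symm)]
      · simp [hb]
    · simp [ha]
  have hPP : P * P = P := by simp [hP, Matrix.diagonal_mul_diagonal]
  have h₁ (x : Matrix n n ℂ) : (P * x).trace = ∑ a, (if wt a = k then x a a else 0) := by
    simp [Matrix.trace, hP, Matrix.diagonal_mul]
  rw [← h₁, ← h₁]
  have h₂ : R * (P * t * P) = (P * s * P) * R := by
    calc R * (P * t * P) = P * (R * t) * P := by
          rw [← mul_assoc, ← mul_assoc, ← hPR]; simp only [mul_assoc]
      _ = P * (s * R) * P := hPtP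
      _ = (P * s * P) * R := by
          simp only [mul_assoc]; rw [hPR]
  have h₃ : P * t * P = R⁻¹ * ((P * s * P) * R) := by
    rw [← h₂, ← mul_assoc, Matrix.nonsing_inv_mul R hu, one_mul]
  have h₄ (x : Matrix n n ℂ) : (P * x * P).trace = (P * x).trace := by
    rw [Matrix.trace_mul_comm, ← mul_assoc, hPP]
  rw [← h₄ t, ← h₄ s, h₃, Matrix.trace_mul_comm, mul_assoc, Matrix.mul_nonsing_inv R hu, mul_one]

end Trace

/-! ### Zero weight and the RLL relation on W[0] -/

namespace Representation

variable {τ η : ℂ} {W : Type*} [AddCommGroup W] [Module ℂ W]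

theorem weight_ℒ (ρ : Representation τ η W) (i j : Fin 3) (w : W) :
    ∀ᶠ p : ℂ × ℂ in residual (ℂ × ℂ),
      ρ.h (ρ.ℒ p.1 p.2 i j w) = ρ.ℒ p.1 p.2 i j (ρ.h w) + (hV j - hV i) • ρ.ℒ p.1 p.2 i j w := by
  filter_upwards [ρ.zero_weight i j w] with p hp
  have h₁ : hV i • ρ.ℒ p.1 p.2 i j w + ρ.h (ρ.ℒ p.1 p.2 i j w)
      = ρ.ℒ p.1 p.2 i j (hV j • w + ρ.h w) := by
    simpa [totalWeight, Matrix.diagonal_mul, Matrix.mul_diagonal] using hp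
  rw [map_add, map_smul] at h₁
  rw [sub_smul, ← add_sub_assoc, eq_sub_iff_add_eq, add_comm, h₁, add_comm]

/-- The exceptional meagre set depends on the vector. This uniform version applies to vectors moving
with the parameters inside a fixed finite-dimensional space, such as the values of another ℒ-entry.
-/
theorem weight_ℒ_span (ρ : Representation τ η W) (i j : Fin 3) (s : Finset W) :
    ∀ᶠ p : ℂ × ℂ in residual (ℂ × ℂ), ∀ x ∈ Submodule.span ℂ (s : Set W),
      ρ.h (ρ.ℒ p.1 p.2 i j x) = ρ.ℒ p.1 p.2 i j (ρ.h x) + (hV j - hV i) • ρ.ℒ p.1 p.2 i j x := by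
  have h := (eventually_all_finset s).2 fun w _ => ρ.weight_ℒ i j w
  filter_upwards [h] with p hp x hx
  induction hx using Submodule.span_induction with
  | mem w hw => exact hp w hw
  | zero => simp
  | add x y _ _ hx hy => simp only [map_add, hx, hy, smul_add]; abel
  | smul c x _ hx => simp only [map_smul, hx, smul_add, smul_comm c]

/-- The product `ℒ_{ij}(q, u) ℒ_{kl}(q - 2 η h_j, v)`, a matrix entry of `ℒ₁₃(q, u) ℒ₂₃(q - 2 η h₁, v)`. -/
def dynMul (ρ : Representation τ η W) (q u v : ℂ) (i j k l : Fin 3) : Module.End ℂ W :=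
  ρ.ℒ q u i j * ρ.ℒ (q - 2 * η * hV j) v k l

/-- Preimages of residual sets under continuous open maps are residual, so generic facts in two
variables pull back to three. -/
theorem tendsto_residual_left (s : ℂ) :
    Tendsto (fun p : ℂ × ℂ × ℂ => (p.1 - s, p.2.1)) (residual (ℂ × ℂ × ℂ)) (residual (ℂ × ℂ)) := by
  refine tendsto_residual_of_isOpenMap (by fun_prop) ?_
  exact ((Homeomorph.subRight s).isOpenMap.prodMap isOpenMap_fst)

theorem tendsto_residual_right (s : ℂ) :
    Tendsto (fun p : ℂ × ℂ × ℂ => (p.1 - s, p.2.2)) (residual (ℂ × ℂ × ℂ)) (residual (ℂ × ℂ)) := by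
  refine tendsto_residual_of_isOpenMap (by fun_prop) ?_
  exact ((Homeomorph.subRight s).isOpenMap.prodMap isOpenMap_snd)

theorem tendsto_residual_diff :
    Tendsto (fun p : ℂ × ℂ × ℂ => (p.1, p.2.1 - p.2.2)) (residual (ℂ × ℂ × ℂ))
      (residual (ℂ × ℂ)) := by
  refine tendsto_residual_of_isOpenMap (by fun_prop) ?_
  exact IsOpenMap.id.prodMap
    ((ContinuousLinearMap.fst ℂ ℂ ℂ - ContinuousLinearMap.snd ℂ ℂ ℂ).isOpenMap
      fun x => ⟨(x, 0), by simp⟩)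

/-- The two factors change the W-weight by h_l - h_k and h_j - h_i, which cancel. -/
theorem weight_dynMul (ρ : Representation τ η W) (i j k l : Fin 3) {w : W}
    (hw : w ∈ ρ.h.eigenspace 0) (hwt : hV i + hV k = hV j + hV l) :
    ∀ᶠ p : ℂ × ℂ × ℂ in residual (ℂ × ℂ × ℂ),
      ρ.dynMul p.1 p.2.1 p.2.2 i j k l w ∈ ρ.h.eigenspace 0 := by
  obtain ⟨s, hs⟩ := (ρ.meromorphic k l w).exists_finset
  filter_upwards [(tendsto_residual_right (2 * η * hV j)).eventually (ρ.weight_ℒ k l w),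
    (tendsto_residual_left 0).eventually (ρ.weight_ℒ_span i j s)] with p h₁ h₂
  have hw' : ρ.h w = 0 := by simpa using Module.End.mem_eigenspace_iff.1 hw
  rw [hw', map_zero, zero_add] at h₁
  have h₃ := h₂ _ (hs (p.1 - 2 * η * hV j, p.2.2))
  simp only [sub_zero] at h₃ h₁
  rw [h₁, map_smul, ← add_smul, show hV l - hV k + (hV j - hV i) = 0 by linear_combination -hwt,
    zero_smul] at h₃
  rw [Module.End.mem_eigenspace_iff, zero_smul]
  exact h₃

/-- Each leg is diagonal in one tensor index, so every entry of a product of two legs is a single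
term, a `dynMul`. -/
theorem rll_apply (ρ : Representation τ η W) (a b : Fin 3 × Fin 3) (w : W) :
    ∀ᶠ p : ℂ × ℂ × ℂ in residual (ℂ × ℂ × ℂ),
      ∑ c, funOf ρ.h ρ.diagonalizable
          (fun μ => RMat τ η (p.1 - 2 * η * μ) (p.2.1 - p.2.2) a c)
          (ρ.dynMul p.1 p.2.1 p.2.2 c.1 b.1 c.2 b.2 w)
        = ∑ c, RMat τ η p.1 (p.2.1 - p.2.2) c b • ρ.dynMul p.1 p.2.2 p.2.1 a.2 c.2 a.1 c.1 w := by
  filter_upwards [ρ.rll a b w] with p hp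
  have h₁ : leg13 (fun x => ρ.ℒ x p.2.1) p.1 0 * leg23 (fun x => ρ.ℒ x p.2.2) p.1 (2 * η)
      = Matrix.of fun a b => ρ.dynMul p.1 p.2.1 p.2.2 a.1 b.1 a.2 b.2 := by
    ext a b : 2
    simp [Matrix.mul_apply, leg13, leg23, dynMul, Fintype.sum_prod_type, ite_mul, mul_ite]
  have h₂ : leg23 (fun x => ρ.ℒ x p.2.2) p.1 0 * leg13 (fun x => ρ.ℒ x p.2.1) p.1 (2 * η)
      = Matrix.of fun a b => ρ.dynMul p.1 p.2.2 p.2.1 a.2 b.2 a.1 b.1 := by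
    ext a b : 2
    simp [Matrix.mul_apply, leg13, leg23, dynMul, Fintype.sum_prod_type, ite_mul, mul_ite]
  simp only at hp
  rw [mul_assoc, h₁, h₂] at hp
  simpa [Matrix.mul_apply, R12Shift, R12, LinearMap.sum_apply] using hp

theorem trace_dynMul_eq (ρ : Representation τ η W) (hτ : 0 < τ.im) (hη : theta τ η ≠ 0)
    (hη' : theta τ (2 * η) ≠ 0) {w : W} (hw : w ∈ ρ.h.eigenspace 0) (k : ℂ) :
    ∀ᶠ p : ℂ × ℂ × ℂ in residual (ℂ × ℂ × ℂ),
      ∑ a : Fin 3 × Fin 3,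
          (if weight a = k then ρ.dynMul p.1 p.2.1 p.2.2 a.1 a.1 a.2 a.2 w else 0)
        = ∑ a : Fin 3 × Fin 3,
          (if weight a = k then ρ.dynMul p.1 p.2.2 p.2.1 a.2 a.2 a.1 a.1 w else 0) := by
  have hwt : ∀ᶠ p : ℂ × ℂ × ℂ in residual (ℂ × ℂ × ℂ), ∀ c b : Fin 3 × Fin 3,
      weight c = weight b → ρ.dynMul p.1 p.2.1 p.2.2 c.1 b.1 c.2 b.2 w ∈ ρ.h.eigenspace 0 := by
    simp only [eventually_all]
    exact fun c b hcb => ρ.weight_dynMul c.1 b.1 c.2 b.2 hw hcb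
  have hrll := eventually_all.2 fun a => eventually_all.2 fun b => ρ.rll_apply a b w
  filter_upwards [hwt, hrll,
    tendsto_residual_diff.eventually (eventually_residual_det_RMat_ne_zero hτ hη hη')]
    with p hp₁ hp₂ hp₃
  rw [← sub_eq_zero, ← Module.forall_dual_apply_eq_zero_iff ℂ]
  intro φ
  rw [map_sub, sub_eq_zero, map_sum, map_sum]
  simp only [apply_ite φ, map_zero]
  refine sum_diag_eq_of_intertwines weight (R := RMat τ η p.1 (p.2.1 - p.2.2))
    (t := Matrix.of fun a b => φ (ρ.dynMul p.1 p.2.1 p.2.2 a.1 b.1 a.2 b.2 w))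
    (s := Matrix.of fun a b => φ (ρ.dynMul p.1 p.2.2 p.2.1 a.2 b.2 a.1 b.1 w))
    hp₃ (fun a b => RMat_eq_zero_of_weight_ne τ η _ _) (fun a b hab => ?_) k
  have h := congrArg φ (hp₂ a b)
  simp only [map_sum, map_smul, smul_eq_mul] at h
  simp only [Matrix.mul_apply, Matrix.of_apply]
  rw [Finset.sum_congr rfl fun c _ => mul_comm _ _, ← Finset.sum_congr rfl fun c _ => mul_comm _ _]
  refine Eq.trans (Finset.sum_congr rfl fun c _ => ?_)
    (h.trans (Finset.sum_congr rfl fun c _ => mul_comm _ _))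
  by_cases hac : weight a = weight c
  · rw [funOf_apply _ _ _ 0 _ (hp₁ c b (hac.symm.trans hab))]
    simp
  -- Here the vector need not lie in W[0], but the entry of R vanishes for every value of the shift.
  · have h₀ : (fun μ => RMat τ η (p.1 - 2 * η * μ) (p.2.1 - p.2.2) a c) = fun _ => 0 :=
      funext fun μ => RMat_eq_zero_of_weight_ne τ η _ _ hac
    rw [RMat_eq_zero_of_weight_ne τ η _ _ hac, h₀, funOf_zero]
    simp

theorem eventually_continuousAt_dynMul (ρ : Representation τ η W) {u v : ℂ} (hu : ρ.IsRegular u)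
    (hv : ρ.IsRegular v) (i j k l : Fin 3) (w : W) :
    ∀ᶠ q in codiscrete ℂ, ∀ φ : Module.Dual ℂ W,
      ContinuousAt (fun p : ℂ × ℂ × ℂ => φ (ρ.dynMul p.1 p.2.1 p.2.2 i j k l w)) (q, u, v) := by
  -- Regularity of the outer factor concerns constant vectors only; expanding the inner factor into
  -- scalars times constant vectors reduces to these.
  suffices H : ∀ f : ℂ × ℂ → W, VecRegularAlong v f → ∀ᶠ q in codiscrete ℂ,
      ∀ φ : Module.Dual ℂ W, ContinuousAt (fun p : ℂ × ℂ × ℂ =>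
        φ (ρ.ℒ p.1 p.2.1 i j (f (p.1 - 2 * η * hV j, p.2.2)))) (q, u, v) from
    H (fun p => ρ.ℒ p.1 p.2 k l w) (hv k l w)
  intro f hf
  induction hf using Submodule.span_induction with
  | mem F hF =>
    obtain ⟨m, x, -, hm, rfl⟩ := hF
    filter_upwards [(tendsto_sub_codiscrete (2 * η * hV j)).eventually hm.eventually_continuousAt,
      (hu i j x).eventually_continuousAt] with q h₁ h₂ φ
    have h₃ : ContinuousAt (fun p : ℂ × ℂ × ℂ => m (p.1 - 2 * η * hV j, p.2.2)) (q, u, v) :=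
      ContinuousAt.comp (g := m) (f := fun p : ℂ × ℂ × ℂ => (p.1 - 2 * η * hV j, p.2.2)) h₁
        (by fun_prop)
    have h₄ : ContinuousAt (fun p : ℂ × ℂ × ℂ => φ (ρ.ℒ p.1 p.2.1 i j x)) (q, u, v) :=
      ContinuousAt.comp (g := fun p : ℂ × ℂ => φ (ρ.ℒ p.1 p.2 i j x))
        (f := fun p : ℂ × ℂ × ℂ => (p.1, p.2.1)) (h₂ φ) (by fun_prop)
    simpa using ContinuousAt.fun_mul h₃ h₄
  | zero => exact Eventually.of_forall fun q φ => by simpa using continuousAt_const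
  | add F G _ _ hF hG =>
    filter_upwards [hF, hG] with q h₁ h₂ φ
    simpa using ContinuousAt.fun_add (h₁ φ) (h₂ φ)
  | smul c F _ hF =>
    filter_upwards [hF] with q h₁ φ
    simpa using (h₁ φ).const_mul c

/-- With R eliminated, weak continuity carries the identity even to (q, u, v) at which R(q, u - v)
is singular. -/
theorem trace_dynMul_eq_of_isRegular (ρ : Representation τ η W) (hτ : 0 < τ.im)
    (hη : theta τ η ≠ 0) (hη' : theta τ (2 * η) ≠ 0) {u v : ℂ} (hu : ρ.IsRegular u)
    (hv : ρ.IsRegular v) {w : W} (hw : w ∈ ρ.h.eigenspace 0) (k : ℂ) :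
    ∀ᶠ q in codiscrete ℂ,
      ∑ a : Fin 3 × Fin 3, (if weight a = k then ρ.dynMul q u v a.1 a.1 a.2 a.2 w else 0)
        = ∑ a : Fin 3 × Fin 3, (if weight a = k then ρ.dynMul q v u a.2 a.2 a.1 a.1 w else 0) := by
  have h₁ := eventually_all.2 fun a : Fin 3 × Fin 3 =>
    ρ.eventually_continuousAt_dynMul hu hv a.1 a.1 a.2 a.2 w
  have h₂ := eventually_all.2 fun a : Fin 3 × Fin 3 =>
    ρ.eventually_continuousAt_dynMul hv hu a.2 a.2 a.1 a.1 w
  filter_upwards [h₁, h₂] with q h₁ h₂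
  refine eq_of_eventually_residual (x := (q, u, v)) (ρ.trace_dynMul_eq hτ hη hη' hw k)
    (fun φ => ?_) (fun φ => ?_)
  · simp only [map_sum, apply_ite φ, map_zero]
    refine tendsto_finsetSum _ fun a _ => ?_
    split_ifs
    · exact h₁ a φ
    · exact tendsto_const_nhds
  · simp only [map_sum, apply_ite φ, map_zero]
    refine tendsto_finsetSum _ fun a _ => ?_
    split_ifs
    · exact ContinuousAt.comp (f := fun p : ℂ × ℂ × ℂ => (p.1, p.2.2, p.2.1))
        (g := fun p : ℂ × ℂ × ℂ => φ (ρ.dynMul p.1 p.2.1 p.2.2 a.2 a.2 a.1 a.1 w))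
        (x := (q, u, v)) (h₂ a φ) (by fun_prop)
    · exact tendsto_const_nhds

/-! ### The transfer matrix -/

theorem transfer_coe (ρ : Representation τ η W) (u : ℂ) (f : ℂ → W) :
    ρ.transfer u (f : Germ (codiscrete ℂ) W)
      = ((fun q => ∑ i, ρ.ℒ q u i i (f (q - 2 * η * hV i)) : ℂ → W) : Germ (codiscrete ℂ) W) := by
  simp only [transfer, Matrix.trace, Matrix.diag_apply, Fin.sum_univ_three]
  rfl

theorem transfer_mem_Fun (ρ : Representation τ η W) {u : ℂ} (hu : ρ.IsRegular u)
    {f : Germ (codiscrete ℂ) W} (hf : f ∈ Fun W) : ρ.transfer u f ∈ Fun W := by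
  induction hf using Submodule.span_induction with
  | mem F hF =>
    obtain ⟨m, w, hm, rfl⟩ := hF
    simp only [transfer, Matrix.trace, LinearMap.sum_apply]
    refine sum_mem fun i _ => ?_
    have := (hu i i w).smul_mem_Fun (meromorphic_comp_sub hm (2 * η * hV i))
    simp only [Matrix.diag_apply, L, Matrix.of_apply, shiftOp_coe, map_smul]
    exact this
  | zero => simp
  | add F G _ _ hF hG => simpa using add_mem hF hG
  | smul c F _ hF => simpa using Submodule.smul_mem _ c hF

/-- Projecting to W[0] fixes the function and moves the constant vectors of any decomposition into
W[0]. -/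
theorem FunZero_eq_span (ρ : Representation τ η W) :
    ρ.FunZero = Submodule.span ℂ {F | ∃ (m : ℂ → ℂ) (w : W), Meromorphic m ∧
      w ∈ ρ.h.eigenspace 0 ∧ F = ((fun q => m q • w : ℂ → W) : Germ (codiscrete ℂ) W)} := by
  refine le_antisymm (fun F hF => ?_) (Submodule.span_le.2 ?_)
  · obtain ⟨hF, hF₀⟩ := hF
    set π := funOf ρ.h ρ.diagonalizable (Pi.single 0 1) with hπ
    have h₁ : F.map π = F := by
      induction F using Germ.inductionOn with | _ f => ?_
      rw [Germ.liftPred_coe] at hF₀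
      rw [Germ.map_coe]
      refine Germ.coe_eq.2 ?_
      filter_upwards [hF₀] with q hq
      simp [hπ, funOf_apply _ _ _ 0 _ hq]
    rw [← h₁]
    clear h₁ hF₀
    induction hF using Submodule.span_induction with
    | mem F hF =>
      obtain ⟨m, w, hm, rfl⟩ := hF
      refine Submodule.subset_span ⟨m, π w, hm, funOf_single_mem_eigenspace_zero _ _ w, ?_⟩
      rw [Germ.map_coe]
      refine Germ.coe_eq.2 (Eventually.of_forall fun q => by simp)
    | zero =>
      convert zero_mem (Submodule.span ℂ _)
      exact Germ.coe_eq.2 (Eventually.of_forall fun q => by simp)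
    | add F G _ _ hF hG =>
      convert add_mem hF hG
      induction F using Germ.inductionOn with | _ f => ?_
      induction G using Germ.inductionOn with | _ g => ?_
      exact Germ.coe_eq.2 (Eventually.of_forall fun q => by simp)
    | smul c F _ hF =>
      convert Submodule.smul_mem _ c hF
      induction F using Germ.inductionOn with | _ f => ?_
      exact Germ.coe_eq.2 (Eventually.of_forall fun q => by simp)
  · rintro F ⟨m, w, hm, hw, rfl⟩
    exact ⟨smul_mem_Fun hm w,
      Germ.liftPred_coe.2 (Eventually.of_forall fun q => Submodule.smul_mem _ _ hw)⟩

theorem ℒ_diag_mem_eigenspace (ρ : Representation τ η W) {u : ℂ} (hu : ρ.IsRegular u) (i : Fin 3)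
    {w : W} (hw : w ∈ ρ.h.eigenspace 0) :
    ∀ᶠ q in codiscrete ℂ, ρ.ℒ q u i i w ∈ ρ.h.eigenspace 0 := by
  have hw' : ρ.h w = 0 := by simpa using Module.End.mem_eigenspace_iff.1 hw
  filter_upwards [(hu i i w).eventually_continuousAt] with q hq
  rw [Module.End.mem_eigenspace_iff, zero_smul]
  refine eq_of_eventually_residual (x := (q, u)) (F := fun p : ℂ × ℂ => ρ.h (ρ.ℒ p.1 p.2 i i w))
    (G := fun _ => 0) ?_ (fun φ => hq (φ ∘ₗ ρ.h)) (fun φ => continuousAt_const)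
  filter_upwards [ρ.weight_ℒ i i w] with p hp
  simpa [hw'] using hp

theorem transfer_mem_FunZero (ρ : Representation τ η W) {u : ℂ} (hu : ρ.IsRegular u)
    {f : Germ (codiscrete ℂ) W} (hf : f ∈ ρ.FunZero) : ρ.transfer u f ∈ ρ.FunZero := by
  refine ⟨ρ.transfer_mem_Fun hu hf.1, ?_⟩
  suffices H : ρ.FunZero ≤ ρ.FunZero.comap (ρ.transfer u) from (H hf).2
  conv_lhs => rw [FunZero_eq_span]
  rw [Submodule.span_le]
  rintro F ⟨m, w, hm, hw, rfl⟩
  refine ⟨ρ.transfer_mem_Fun hu (smul_mem_Fun hm w), ?_⟩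
  rw [transfer_coe, Germ.liftPred_coe]
  filter_upwards [eventually_all.2 fun i => ρ.ℒ_diag_mem_eigenspace hu i hw] with q hq
  refine sum_mem fun i _ => ?_
  rw [map_smul]
  exact Submodule.smul_mem _ _ (hq i)

theorem transfer_transfer_coe (ρ : Representation τ η W) (u v : ℂ) (m : ℂ → ℂ) (w : W) :
    ρ.transfer u (ρ.transfer v ((fun q => m q • w : ℂ → W) : Germ (codiscrete ℂ) W))
      = ((fun q => ∑ a : Fin 3 × Fin 3, m (q - 2 * η * weight a) •
          ρ.dynMul q u v a.1 a.1 a.2 a.2 w : ℂ → W) : Germ (codiscrete ℂ) W) := by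
  rw [transfer_coe, transfer_coe]
  congr 1
  ext q
  simp only [map_sum, map_smul, Fintype.sum_prod_type, dynMul, weight, Module.End.mul_apply]
  refine Finset.sum_congr rfl fun i _ => Finset.sum_congr rfl fun j _ => ?_
  congr 2
  ring

theorem transfer_comm (ρ : Representation τ η W) (hτ : 0 < τ.im)
    (hη : theta τ η ≠ 0) (hη' : theta τ (2 * η) ≠ 0) {u v : ℂ} (hu : ρ.IsRegular u)
    (hv : ρ.IsRegular v) {f : Germ (codiscrete ℂ) W} (hf : f ∈ ρ.FunZero) :
    ρ.transfer u (ρ.transfer v f) = ρ.transfer v (ρ.transfer u f) := by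
  classical
  rw [FunZero_eq_span] at hf
  induction hf using Submodule.span_induction with
  | mem F hF =>
    obtain ⟨m, w, hm, hw, rfl⟩ := hF
    rw [transfer_transfer_coe, transfer_transfer_coe]
    refine Germ.coe_eq.2 ?_
    have h := (eventually_all_finset (Finset.univ.image weight)).2 fun k _ =>
      ρ.trace_dynMul_eq_of_isRegular hτ hη hη' hu hv hw k
    filter_upwards [h] with q hq
    -- Grouping by total weight k makes the shifted scalar a common factor of each block trace.
    have e (g : Fin 3 × Fin 3 → W) : ∑ a, m (q - 2 * η * weight a) • g a
        = ∑ k ∈ Finset.univ.image weight, m (q - 2 * η * k) •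
          ∑ a, (if weight a = k then g a else 0) := by
      simp only [Finset.smul_sum, smul_ite, smul_zero]
      rw [Finset.sum_comm]
      refine Finset.sum_congr rfl fun a _ => ?_
      simp
    -- The right side of RLL carries the legs in the opposite order; swapping the indices restores
    -- it without changing the weight.
    rw [e, Finset.sum_congr rfl fun k hk => by rw [hq k hk], ← e,
      ← (Equiv.prodComm (Fin 3) (Fin 3)).sum_comp]
    simp [weight, add_comm]
  | zero => simp
  | add F G _ _ hF hG => simp only [map_add, hF, hG]
  | smul c F _ hF => simp only [map_smul, hF]

end Representation

end EllipticSO3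

theorem mainTheorem2 (τ η : ℂ) (hτ : 0 < τ.im)
    (hη : EllipticSO3.theta τ η ≠ 0) (hη' : EllipticSO3.theta τ (2 * η) ≠ 0)
    (W : Type*) [AddCommGroup W] [Module ℂ W] (ρ : EllipticSO3.Representation τ η W) :
    (∀ u : ℂ, ρ.IsRegular u →
      (∀ f ∈ EllipticSO3.Fun W, ρ.transfer u f ∈ EllipticSO3.Fun W) ∧
      (∀ f ∈ ρ.FunZero, ρ.transfer u f ∈ ρ.FunZero)) ∧
    (∀ u v : ℂ, ρ.IsRegular u → ρ.IsRegular v → ∀ f ∈ ρ.FunZero,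
      ρ.transfer u (ρ.transfer v f) = ρ.transfer v (ρ.transfer u f)) :=
  ⟨fun _ hu => ⟨fun _ => ρ.transfer_mem_Fun hu, fun _ => ρ.transfer_mem_FunZero hu⟩,
    fun _ _ hu hv _ => ρ.transfer_comm hτ hη hη' hu hv⟩
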